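/- Theorem 1.1. For $m\ge 0$ let $T_m$ be the set of $321$-avoiding permutations in the symmetric group $S_m$, that is, of permutations with no decreasing subsequence of length three. For a permutation $\pi$, let $\mathrm{lis}(\pi)$ be the length of a longest increasing subsequence of $\pi$ and $\mathrm{sign}(\pi)\in\{1,-1\}$ its sign. Then for all $n\ge 1$, the following identities hold in $\mathbb{Z}[q]$: $$\sum_{\pi\in T_{2n+1}} \mathrm{sign}(\pi)\, q^{\mathrm{lis}(\pi)} = \sum_{\pi\in T_n} q^{2\,\mathrm{lis}(\pi)+1},$$ $$\sum_{\pi\in T_{2n+2}} \mathrm{sign}(\pi)\, q^{\mathrm{lis}(\pi)} = (q-1)\sum_{\pi\in T_n} q^{2\,\mathrm{lis}(\pi)+1}.$$ -/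

import Mathlib

open Polynomial

/-- A permutation of `Fin m` is 321-avoiding if it has no decreasing subsequence of
length three. -/
def Avoids321 {m : ℕ} (π : Equiv.Perm (Fin m)) : Prop :=
  ∀ i j k : Fin m, i < j → j < k → ¬ (π k < π j ∧ π j < π i)

instance {m : ℕ} : DecidablePred (Avoids321 (m := m)) := fun π =>
  inferInstanceAs (Decidable (∀ i j k : Fin m, i < j → j < k → ¬ (π k < π j ∧ π j < π i)))

/-- The set `T_m` of 321-avoiding permutations in the symmetric group on `m` letters. -/
def perms321 (m : ℕ) : Finset (Equiv.Perm (Fin m)) :=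
  Finset.univ.filter Avoids321

/-- The length of the longest increasing subsequence of `π`: the largest size of a set of
positions on which `π` is strictly increasing. -/
def lis {m : ℕ} (π : Equiv.Perm (Fin m)) : ℕ :=
  (Finset.univ.filter fun S : Finset (Fin m) => ∀ i ∈ S, ∀ j ∈ S, i < j → π i < π j).sup
    Finset.card

open Finset

/-! Build 321-avoiding permutations by prepending a first letter `v`. The result avoids 321 exactly
when the old values below `v` are increasing, i.e. `v ≤ r` with r = `incRank`. A second label, a =
`lisDrop`, governs the growth of `lis`: the letter 0 leads from (r, a) to (r + 1, a + 1) and raises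
`lis` by one, while 1 ≤ v ≤ r leads to (v, min (v - 1) (a - 1)) and raises `lis` only if a = 0. That
two numbers suffice is `lisAbove_add_min`. The sign changes by (-1)^v, so both sides of the theorem
are iterates of an operator `transfer` on functions of (r, a), applied to the constant 1 and read at
(0, 0) (`sum_perms321_eq_iterate`).

The identity then follows from an intertwining relation. Write T for the signed operator at q and U
for the unsigned one at q². On a ≤ r, T² ∘ `double` = `double` ∘ U (`transfer_transfer_double`) and
(q + 1) T 1 = `double` 1 (`transfer_one_eq_double`), whence (q + 1) T^(2n+1) 1 = `double` (U^n 1).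
Reading this at (0, 0) and at (1, 1) gives the odd and the even case. -/

/-! ### Prepending a first letter. -/

/-- The permutation with first letter `v` whose remaining letters are order-isomorphic to `π`. -/
def prepend {m : ℕ} (v : Fin (m + 1)) (π : Equiv.Perm (Fin m)) : Equiv.Perm (Fin (m + 1)) :=
  v.cycleRange.symm * Equiv.Perm.decomposeFin.symm (0, π)

@[simp]
theorem prepend_zero {m : ℕ} (v : Fin (m + 1)) (π : Equiv.Perm (Fin m)) :
    prepend v π 0 = v := by
  simp [prepend]

@[simp]
theorem prepend_succ {m : ℕ} (v : Fin (m + 1)) (π : Equiv.Perm (Fin m)) (i : Fin m) :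
    prepend v π i.succ = v.succAbove (π i) := by
  simp [prepend]

theorem sign_prepend {m : ℕ} (v : Fin (m + 1)) (π : Equiv.Perm (Fin m)) :
    Equiv.Perm.sign (prepend v π) = (-1) ^ (v : ℕ) * Equiv.Perm.sign π := by
  simp [prepend, Equiv.Perm.decomposeFin.symm_sign]

theorem prepend_bijective (m : ℕ) :
    Function.Bijective
      (fun x : Fin (m + 1) × Equiv.Perm (Fin m) => prepend x.1 x.2) := by
  rw [Fintype.bijective_iff_injective_and_card]
  refine ⟨?_, ?_⟩
  · rintro ⟨v, π⟩ ⟨w, ρ⟩ h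
    have h0 : v = w := by simpa using congrArg (fun σ => σ 0) h
    subst h0
    have : π = ρ := Equiv.ext fun i => by simpa using congrArg (fun σ => σ i.succ) h
    rw [this]
  · simp [Fintype.card_perm, Nat.factorial_succ]

theorem succAbove_lt_self_iff {m : ℕ} (v : Fin (m + 1)) (x : Fin m) :
    v.succAbove x < v ↔ (x : ℕ) < v := by
  rw [Fin.succAbove_lt_iff_castSucc_lt, Fin.lt_def, Fin.val_castSucc]

theorem self_lt_succAbove_iff {m : ℕ} (v : Fin (m + 1)) (x : Fin m) :
    v < v.succAbove x ↔ (v : ℕ) ≤ x := by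
  rw [Fin.lt_succAbove_iff_le_castSucc, Fin.le_def, Fin.val_castSucc]

theorem val_succAbove_eq {m : ℕ} (v : Fin (m + 1)) (x : Fin m) :
    (v.succAbove x : ℕ) = if (x : ℕ) < v then (x : ℕ) else x + 1 := by
  simp only [Fin.succAbove, Fin.lt_def, Fin.val_castSucc]
  split_ifs <;> simp

/-! ### The first label: how many of the smallest values appear in order. -/

/-- The values of `π` below `w` appear in increasing order. -/
def IncBelow {m : ℕ} (π : Equiv.Perm (Fin m)) (w : ℕ) : Prop :=
  ∀ i j : Fin m, i < j → π j < π i → w ≤ (π i : ℕ)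

instance {m : ℕ} (π : Equiv.Perm (Fin m)) : DecidablePred (IncBelow π) := fun w =>
  inferInstanceAs (Decidable (∀ i j : Fin m, i < j → π j < π i → w ≤ (π i : ℕ)))

theorem IncBelow.mono {m : ℕ} {π : Equiv.Perm (Fin m)} {w w' : ℕ} (h : IncBelow π w)
    (hw : w' ≤ w) : IncBelow π w' :=
  fun i j hij hji => hw.trans (h i j hij hji)

/-- A new 321 pattern must start at the first letter, so it is an inversion of `π` whose larger
value lies below `v`. -/
theorem avoids321_prepend {m : ℕ} (v : Fin (m + 1)) (π : Equiv.Perm (Fin m)) :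
    Avoids321 (prepend v π) ↔ Avoids321 π ∧ IncBelow π v := by
  constructor
  · intro h
    refine ⟨fun i j k hij hjk hd => h i.succ j.succ k.succ (by simpa) (by simpa) (by simpa),
      fun i j hij hd => ?_⟩
    by_contra hlt
    refine h 0 i.succ j.succ (Fin.succ_pos i) (by simpa) ⟨by simpa, ?_⟩
    simpa [succAbove_lt_self_iff] using hlt
  · rintro ⟨h, hv⟩ i j k hij hjk ⟨h1, h2⟩
    have hj : j ≠ 0 := (Fin.pos_of_ne_zero (by rintro rfl; simp at hij)).ne'
    have hk : k ≠ 0 := (Fin.pos_of_ne_zero (by rintro rfl; simp at hjk)).ne'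
    obtain ⟨j, rfl⟩ := Fin.exists_succ_eq.2 hj
    obtain ⟨k, rfl⟩ := Fin.exists_succ_eq.2 hk
    simp only [prepend_succ, Fin.succAbove_lt_succAbove_iff, Fin.succ_lt_succ_iff] at h1 hjk
    rcases Fin.eq_zero_or_eq_succ i with rfl | ⟨i, rfl⟩
    · rw [prepend_succ, prepend_zero, succAbove_lt_self_iff] at h2
      exact absurd (hv j k hjk h1) (by omega)
    · simp only [prepend_succ, Fin.succAbove_lt_succAbove_iff, Fin.succ_lt_succ_iff] at h2 hij
      exact h i j k hij hjk ⟨h1, h2⟩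

theorem incBelow_prepend_zero {m : ℕ} (π : Equiv.Perm (Fin m)) (w : ℕ) :
    IncBelow (prepend 0 π) (w + 1) ↔ IncBelow π w := by
  constructor
  · intro h i j hij hd
    simpa using h i.succ j.succ (by simpa) (by simpa)
  · intro h i j hij hd
    have hj : j ≠ 0 := (Fin.pos_of_ne_zero (by rintro rfl; simp at hij)).ne'
    obtain ⟨j, rfl⟩ := Fin.exists_succ_eq.2 hj
    rcases Fin.eq_zero_or_eq_succ i with rfl | ⟨i, rfl⟩
    · simp at hd
    · simp only [prepend_succ, Fin.succAbove_lt_succAbove_iff, Fin.succ_lt_succ_iff] at hd hij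
      simpa using h i j hij hd

theorem incBelow_prepend {m : ℕ} {v : Fin (m + 1)} {π : Equiv.Perm (Fin m)} (hv : v ≠ 0)
    (h : IncBelow π v) (w : ℕ) : IncBelow (prepend v π) w ↔ w ≤ v := by
  constructor
  · intro hw
    have hm : 0 < m := by
      have := Fin.pos_of_ne_zero hv
      rw [Fin.lt_def] at this
      have := v.2
      simp at *
      omega
    -- The first letter `v > 0` forms an inversion with the later value 0, which forces `w ≤ v`.
    have := hw 0 (π.symm ⟨0, hm⟩).succ (Fin.succ_pos _) (by
      rw [prepend_succ, prepend_zero, succAbove_lt_self_iff]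
      simpa [Fin.pos_iff_ne_zero] using Fin.pos_of_ne_zero hv)
    simpa using this
  · intro hw i j hij hd
    refine hw.trans ?_
    have hj : j ≠ 0 := (Fin.pos_of_ne_zero (by rintro rfl; simp at hij)).ne'
    obtain ⟨j, rfl⟩ := Fin.exists_succ_eq.2 hj
    rcases Fin.eq_zero_or_eq_succ i with rfl | ⟨i, rfl⟩
    · simp
    · simp only [prepend_succ, Fin.succAbove_lt_succAbove_iff, Fin.succ_lt_succ_iff] at hd hij
      have := (self_lt_succAbove_iff v (π i)).2 (h i j hij hd)
      rw [prepend_succ]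
      exact this.le

/-- The largest `w ≤ m` such that the values of `π` below `w` appear in increasing order. -/
def incRank {m : ℕ} (π : Equiv.Perm (Fin m)) : ℕ :=
  Nat.findGreatest (IncBelow π) m

theorem incRank_le {m : ℕ} (π : Equiv.Perm (Fin m)) : incRank π ≤ m :=
  Nat.findGreatest_le m

theorem incBelow_iff_le_incRank {m : ℕ} (π : Equiv.Perm (Fin m)) {w : ℕ} (hw : w ≤ m) :
    IncBelow π w ↔ w ≤ incRank π := by
  refine ⟨fun h => Nat.le_findGreatest hw h, fun h => ?_⟩
  have : IncBelow π (incRank π) :=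
    Nat.findGreatest_spec (P := IncBelow π) (Nat.zero_le m) (fun _ _ _ _ => Nat.zero_le _)
  exact this.mono h

theorem incRank_prepend_zero {m : ℕ} (π : Equiv.Perm (Fin m)) :
    incRank (prepend 0 π) = incRank π + 1 := by
  have hle := incRank_le π
  apply le_antisymm
  · have h1 := incRank_le (prepend 0 π)
    have h2 := (incBelow_iff_le_incRank (prepend 0 π) h1).2 le_rfl
    rcases h : incRank (prepend 0 π) with _ | w
    · omega
    · rw [h] at h1 h2
      have := (incBelow_iff_le_incRank π (by omega)).1 ((incBelow_prepend_zero π w).1 h2)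
      omega
  · rw [← incBelow_iff_le_incRank _ (by omega), incBelow_prepend_zero,
      incBelow_iff_le_incRank _ hle]

theorem incRank_prepend {m : ℕ} {v : Fin (m + 1)} {π : Equiv.Perm (Fin m)} (hv : v ≠ 0)
    (h : (v : ℕ) ≤ incRank π) : incRank (prepend v π) = v := by
  have hi := (incBelow_iff_le_incRank π (h.trans (incRank_le π))).2 h
  have h1 := incRank_le (prepend v π)
  apply le_antisymm
  · rw [← incBelow_prepend hv hi, incBelow_iff_le_incRank _ h1]
  · rw [← incBelow_iff_le_incRank _ v.2.le, incBelow_prepend hv hi]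

/-! ### The second label: increasing subsequences among the large values. -/

/-- `π` is increasing on the positions in `S`, with all values there at least `w`. -/
def IncAbove {m : ℕ} (π : Equiv.Perm (Fin m)) (w : ℕ) (S : Finset (Fin m)) : Prop :=
  (∀ i ∈ S, ∀ j ∈ S, i < j → π i < π j) ∧ ∀ i ∈ S, w ≤ (π i : ℕ)

instance {m : ℕ} (π : Equiv.Perm (Fin m)) (w : ℕ) : DecidablePred (IncAbove π w) := fun S =>
  inferInstanceAs
    (Decidable ((∀ i ∈ S, ∀ j ∈ S, i < j → π i < π j) ∧ ∀ i ∈ S, w ≤ (π i : ℕ)))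

/-- The length of a longest increasing subsequence of `π` among the values at least `w`. -/
def lisAbove {m : ℕ} (π : Equiv.Perm (Fin m)) (w : ℕ) : ℕ :=
  (univ.filter (IncAbove π w)).sup card

theorem lis_eq_lisAbove {m : ℕ} (π : Equiv.Perm (Fin m)) : lis π = lisAbove π 0 := by
  simp only [lis, lisAbove, IncAbove, Nat.zero_le, implies_true, and_true]
  congr! with S
  simp [IncAbove]

theorem IncAbove.card_le {m : ℕ} {π : Equiv.Perm (Fin m)} {w : ℕ} {S : Finset (Fin m)}
    (h : IncAbove π w S) : #S ≤ lisAbove π w :=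
  le_sup (f := card) (by simpa using h)

theorem exists_incAbove {m : ℕ} (π : Equiv.Perm (Fin m)) (w : ℕ) :
    ∃ S, IncAbove π w S ∧ #S = lisAbove π w := by
  obtain ⟨S, hS, h⟩ := exists_mem_eq_sup (univ.filter (IncAbove π w))
    ⟨∅, by simp [IncAbove]⟩ card
  exact ⟨S, by simpa using hS, h.symm⟩

theorem map_succ_filter_succ_mem {m : ℕ} (S : Finset (Fin (m + 1))) :
    (univ.filter fun i : Fin m => i.succ ∈ S).map (Fin.succEmb m) = S.erase 0 := by
  ext i
  rcases Fin.eq_zero_or_eq_succ i with rfl | ⟨i, rfl⟩ <;> simp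

theorem card_filter_succ_mem {m : ℕ} (S : Finset (Fin (m + 1))) :
    #(univ.filter fun i : Fin m => i.succ ∈ S) = #(S.erase 0) := by
  rw [← map_succ_filter_succ_mem, card_map]

theorem IncAbove.filter_succ_mem {m : ℕ} {v : Fin (m + 1)} {π : Equiv.Perm (Fin m)} {w w' : ℕ}
    {S : Finset (Fin (m + 1))} (h : IncAbove (prepend v π) w S)
    (hw : ∀ i : Fin m, i.succ ∈ S → w' ≤ π i) :
    IncAbove π w' (univ.filter fun i : Fin m => i.succ ∈ S) := by
  refine ⟨fun i hi j hj hij => ?_, fun i hi => hw i (by simpa using hi)⟩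
  simpa using h.1 i.succ (by simpa using hi) j.succ (by simpa using hj) (by simpa)

theorem IncAbove.map_succ {m : ℕ} {v : Fin (m + 1)} {π : Equiv.Perm (Fin m)} {w w' : ℕ}
    {S : Finset (Fin m)} (h : IncAbove π w' S)
    (hw : ∀ i ∈ S, w ≤ (v.succAbove (π i) : ℕ)) :
    IncAbove (prepend v π) w (S.map (Fin.succEmb m)) := by
  refine ⟨?_, ?_⟩
  · simp only [mem_map, Fin.coe_succEmb]
    rintro _ ⟨i, hi, rfl⟩ _ ⟨j, hj, rfl⟩ hij
    simpa using h.1 i hi j hj (by simpa using hij)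
  · simp only [mem_map, Fin.coe_succEmb]
    rintro _ ⟨i, hi, rfl⟩
    simpa using hw i hi

theorem lisAbove_prepend_of_lt {m : ℕ} {v : Fin (m + 1)} (π : Equiv.Perm (Fin m)) {w : ℕ}
    (h : (v : ℕ) ≤ w) : lisAbove (prepend v π) (w + 1) = lisAbove π w := by
  apply le_antisymm
  · obtain ⟨S, hS, hc⟩ := exists_incAbove (prepend v π) (w + 1)
    have h0 : (0 : Fin (m + 1)) ∉ S := fun h0 => by
      have := hS.2 0 h0
      rw [prepend_zero] at this
      omega
    rw [← hc, ← erase_eq_of_notMem h0, ← card_filter_succ_mem]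
    refine (hS.filter_succ_mem fun i hi => ?_).card_le
    have := hS.2 _ hi
    rw [prepend_succ, val_succAbove_eq] at this
    split_ifs at this <;> omega
  · obtain ⟨S, hS, hc⟩ := exists_incAbove π w
    rw [← hc, ← card_map (Fin.succEmb m)]
    refine (hS.map_succ fun i hi => ?_).card_le
    have := hS.2 i hi
    rw [val_succAbove_eq]
    split_ifs <;> omega

/-- An increasing subsequence either skips the first letter or starts there and continues with
values above `v`. -/
theorem lisAbove_prepend_of_le {m : ℕ} {v : Fin (m + 1)} (π : Equiv.Perm (Fin m)) {w : ℕ}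
    (h : w ≤ v) : lisAbove (prepend v π) w = max (lisAbove π w) (lisAbove π v + 1) := by
  apply le_antisymm
  · obtain ⟨S, hS, hc⟩ := exists_incAbove (prepend v π) w
    rw [← hc]
    by_cases h0 : (0 : Fin (m + 1)) ∈ S
    · refine le_max_of_le_right ?_
      rw [← card_erase_add_one h0, ← card_filter_succ_mem]
      refine Nat.succ_le_succ (hS.filter_succ_mem fun i hi => ?_).card_le
      have := hS.1 0 h0 _ hi (Fin.succ_pos i)
      rwa [prepend_zero, prepend_succ, self_lt_succAbove_iff] at this
    · refine le_max_of_le_left ?_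
      rw [← erase_eq_of_notMem h0, ← card_filter_succ_mem]
      refine (hS.filter_succ_mem fun i hi => ?_).card_le
      have := hS.2 _ hi
      rw [prepend_succ, val_succAbove_eq] at this
      split_ifs at this <;> omega
  · refine max_le ?_ ?_
    · obtain ⟨S, hS, hc⟩ := exists_incAbove π w
      rw [← hc, ← card_map (Fin.succEmb m)]
      refine (hS.map_succ fun i hi => ?_).card_le
      have := hS.2 i hi
      rw [val_succAbove_eq]
      split_ifs <;> omega
    · obtain ⟨S, hS, hc⟩ := exists_incAbove π v
      have h0 : (0 : Fin (m + 1)) ∉ S.map (Fin.succEmb m) := by simp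
      rw [← hc, ← card_map (Fin.succEmb m), ← card_insert_of_notMem h0]
      have hw : ∀ i ∈ S, v < v.succAbove (π i) := fun i hi =>
        (self_lt_succAbove_iff v (π i)).2 (hS.2 i hi)
      have hS' := hS.map_succ (v := v) (w := w) fun i hi => h.trans (hw i hi).le
      refine IncAbove.card_le ⟨?_, ?_⟩
      · intro i hi j hj hij
        rcases mem_insert.1 hj with rfl | hj
        · simp at hij
        · rcases mem_insert.1 hi with rfl | hi
          · obtain ⟨j, hj, rfl⟩ := mem_map.1 hj
            simpa using hw j (by simpa using hj)
          · exact hS'.1 i hi j hj hij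
      · intro i hi
        rcases mem_insert.1 hi with rfl | hi
        · simpa using h
        · exact hS'.2 i hi

/-- The loss in the length of a longest increasing subsequence of `π` when the values below
`incRank π` are deleted. -/
def lisDrop {m : ℕ} (π : Equiv.Perm (Fin m)) : ℕ :=
  lis π - lisAbove π (incRank π)

theorem lis_prepend_zero {m : ℕ} (π : Equiv.Perm (Fin m)) :
    lis (prepend 0 π) = lis π + 1 := by
  simp only [lis_eq_lisAbove]
  rw [lisAbove_prepend_of_le π (by simp)]
  simp

theorem lisAbove_le_lis {m : ℕ} (π : Equiv.Perm (Fin m)) (w : ℕ) : lisAbove π w ≤ lis π := by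
  obtain ⟨S, hS, hc⟩ := exists_incAbove π w
  rw [← hc, lis_eq_lisAbove]
  exact IncAbove.card_le ⟨hS.1, fun _ _ => Nat.zero_le _⟩

theorem lisDrop_prepend_zero {m : ℕ} (π : Equiv.Perm (Fin m)) :
    lisDrop (prepend 0 π) = lisDrop π + 1 := by
  have := lisAbove_le_lis π (incRank π)
  rw [lisDrop, lis_prepend_zero, incRank_prepend_zero, lisAbove_prepend_of_lt π (by simp), lisDrop]
  omega

theorem lisAbove_prepend_self {m : ℕ} (v : Fin (m + 1)) (π : Equiv.Perm (Fin m)) :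
    lisAbove (prepend v π) v = lisAbove π v + 1 := by
  rw [lisAbove_prepend_of_le π le_rfl]
  simp

theorem lis_prepend {m : ℕ} (v : Fin (m + 1)) (π : Equiv.Perm (Fin m)) :
    lis (prepend v π) = max (lis π) (lisAbove π v + 1) := by
  rw [lis_eq_lisAbove, lisAbove_prepend_of_le π (Nat.zero_le _), lis_eq_lisAbove]

/-- Deleting the smallest values one by one costs one unit of `lis` each until the total loss
`lisDrop` is used up, and nothing afterwards. Hence all the numbers `lisAbove π w` with `w ≤ incRank
π` are determined by `lis π` and `lisDrop π`. -/
theorem lisAbove_add_min {m : ℕ} {π : Equiv.Perm (Fin m)} (hπ : Avoids321 π) {w : ℕ}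
    (hw : w ≤ incRank π) : lisAbove π w + min w (lisDrop π) = lis π := by
  induction m generalizing w with
  | zero =>
    have := incRank_le π
    obtain rfl : w = 0 := by omega
    simp [lis_eq_lisAbove]
  | succ m ih =>
    obtain ⟨⟨v, π⟩, rfl⟩ := (prepend_bijective m).2 π
    simp only at hw hπ ⊢
    obtain ⟨hav, hv⟩ := (avoids321_prepend v π).1 hπ
    by_cases h0 : v = 0
    · subst h0
      rw [incRank_prepend_zero] at hw
      rw [lisDrop_prepend_zero, lis_prepend_zero]
      rcases w with _ | w
      · rw [← lis_eq_lisAbove, lis_prepend_zero]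
        simp
      · rw [lisAbove_prepend_of_lt π (by simp)]
        have := ih hav (Nat.le_of_succ_le_succ hw)
        omega
    · have hm : (v : ℕ) ≤ m := by omega
      have hv := (incBelow_iff_le_incRank π hm).1 hv
      have hv0 : 1 ≤ (v : ℕ) := Nat.one_le_iff_ne_zero.2 (fun h => h0 (Fin.ext h))
      have h2 : lisDrop (prepend v π) = max (lis π) (lisAbove π v + 1) - (lisAbove π v + 1) := by
        rw [lisDrop, incRank_prepend h0 hv, lisAbove_prepend_self, lis_prepend]
      rw [incRank_prepend h0 hv] at hw
      rw [h2, lis_prepend, lisAbove_prepend_of_le π hw]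
      have e1 := ih hav hv
      have e2 := ih hav (hw.trans hv)
      omega

theorem lis_prepend_of_ne_zero {m : ℕ} {v : Fin (m + 1)} {π : Equiv.Perm (Fin m)}
    (hπ : Avoids321 π) (hv : v ≠ 0) (h : (v : ℕ) ≤ incRank π) :
    lis (prepend v π) = lis π + if lisDrop π = 0 then 1 else 0 := by
  have hv0 : 1 ≤ (v : ℕ) := Nat.one_le_iff_ne_zero.2 (fun h => hv (Fin.ext h))
  rw [lis_prepend]
  have := lisAbove_add_min hπ h
  split_ifs <;> omega

theorem lisDrop_prepend {m : ℕ} {v : Fin (m + 1)} {π : Equiv.Perm (Fin m)}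
    (hπ : Avoids321 π) (hv : v ≠ 0) (h : (v : ℕ) ≤ incRank π) :
    lisDrop (prepend v π) = min ((v : ℕ) - 1) (lisDrop π - 1) := by
  have hv0 : 1 ≤ (v : ℕ) := Nat.one_le_iff_ne_zero.2 (fun h => hv (Fin.ext h))
  rw [lisDrop, lis_prepend, incRank_prepend hv h, lisAbove_prepend_self]
  have := lisAbove_add_min hπ h
  omega

/-! ### The transfer operator of the generating tree. -/

/-- The sum of `g` over the descendants of a node of the generating tree other than the one
obtained by prepending the smallest letter, with a factor `ε` per inversion. -/
def childSum {R : Type*} [CommRing R] (ε : R) (g : ℕ → ℕ → R) (r b : ℕ) : R :=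
  ∑ j ∈ range r, ε ^ (j + 1) * g (j + 1) (min j b)

/-- The transfer operator of the generating tree of 321-avoiding permutations, acting on
functions of `incRank` and `lisDrop`. The parameter `t` marks the length of a longest increasing
subsequence and `ε` marks inversions. -/
def transfer {R : Type*} [CommRing R] (ε t : R) (g : ℕ → ℕ → R) (r a : ℕ) : R :=
  t * g (r + 1) (a + 1) +
    (if a = 0 then t else 1) * childSum ε g r (a - 1)

theorem sum_perms321_succ {R : Type*} [CommRing R] (m : ℕ) (F : Equiv.Perm (Fin (m + 1)) → R) :
    ∑ π ∈ perms321 (m + 1), F π =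
      ∑ π ∈ perms321 m, ∑ v : Fin (m + 1),
        if (v : ℕ) ≤ incRank π then F (prepend v π) else 0 := by
  rw [perms321, perms321, sum_filter, sum_filter,
    ← (Equiv.ofBijective _ (prepend_bijective m)).sum_comp, Fintype.sum_prod_type_right]
  refine sum_congr rfl fun π _ => ?_
  split_ifs with h
  · refine sum_congr rfl fun v _ => ?_
    simp only [Equiv.ofBijective_apply, avoids321_prepend, h, true_and]
    simp only [incBelow_iff_le_incRank π (Nat.lt_succ_iff.1 v.2)]
  · refine sum_eq_zero fun v _ => ?_
    simp [avoids321_prepend, h]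

/-- A general character `χ` treats the signed sum and the unsigned sum (`χ = 1`) at once. -/
theorem sum_perms321_transfer {R : Type*} [CommRing R] (χ : ℤˣ →* R) (t : R) (m : ℕ)
    (g : ℕ → ℕ → R) :
    ∑ π ∈ perms321 (m + 1), χ (Equiv.Perm.sign π) * t ^ lis π * g (incRank π) (lisDrop π) =
      ∑ π ∈ perms321 m, χ (Equiv.Perm.sign π) * t ^ lis π *
        transfer (χ (-1)) t g (incRank π) (lisDrop π) := by
  rw [sum_perms321_succ]
  refine sum_congr rfl fun π hπ => ?_
  have hπ : Avoids321 π := by simpa [perms321] using hπ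
  have hr := incRank_le π
  -- The summand depends on `v` only as a natural number, so the sum over `Fin (m + 1)` can be
  -- turned into one over a range.
  let f : ℕ → R := fun v => χ (Equiv.Perm.sign π) * t ^ lis π *
    if v = 0 then t * g (incRank π + 1) (lisDrop π + 1)
    else (if lisDrop π = 0 then t else 1) *
      ((χ (-1)) ^ v * g v (min (v - 1) (lisDrop π - 1)))
  have key : ∀ v : Fin (m + 1), (if (v : ℕ) ≤ incRank π then
      χ (Equiv.Perm.sign (prepend v π)) * t ^ lis (prepend v π) *
        g (incRank (prepend v π)) (lisDrop (prepend v π)) else 0) =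
      if (v : ℕ) ≤ incRank π then f v else 0 := by
    intro v
    split_ifs with hv
    · rw [sign_prepend, map_mul, map_pow]
      by_cases h0 : v = 0
      · subst h0
        rw [lis_prepend_zero, incRank_prepend_zero, lisDrop_prepend_zero]
        simp only [f, Fin.val_zero, if_true]
        ring
      · have h0' : (v : ℕ) ≠ 0 := fun h => h0 (Fin.ext h)
        rw [lis_prepend_of_ne_zero hπ h0 hv, incRank_prepend h0 hv, lisDrop_prepend hπ h0 hv]
        simp only [f, h0', if_false]
        split_ifs <;> ring
    · rfl
  rw [sum_congr rfl fun v _ => key v,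
    Fin.sum_univ_eq_sum_range (fun v => if v ≤ incRank π then f v else 0) (m + 1), ← sum_filter]
  have : (range (m + 1)).filter (fun v => v ≤ incRank π) = range (incRank π + 1) := by
    ext v
    simp only [mem_filter, mem_range]
    omega
  rw [this, sum_range_succ', transfer, childSum]
  simp only [f, if_true, Nat.succ_ne_zero, if_false, Nat.add_sub_cancel, ← mul_sum]
  ring

theorem sum_perms321_eq_iterate {R : Type*} [CommRing R] (χ : ℤˣ →* R) (t : R) (m : ℕ)
    (g : ℕ → ℕ → R) :
    ∑ π ∈ perms321 m, χ (Equiv.Perm.sign π) * t ^ lis π * g (incRank π) (lisDrop π) =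
      (transfer (χ (-1)) t)^[m] g 0 0 := by
  induction m generalizing g with
  | zero =>
    have h : perms321 0 = univ := by
      ext π
      simp [perms321, Avoids321]
    have hl (π : Equiv.Perm (Fin 0)) : lis π = 0 := by
      rw [lis_eq_lisAbove]
      obtain ⟨S, -, hc⟩ := exists_incAbove π 0
      rw [← hc, S.eq_empty_of_isEmpty, card_empty]
    have hr (π : Equiv.Perm (Fin 0)) : incRank π = 0 := Nat.le_zero.1 (incRank_le π)
    have hd (π : Equiv.Perm (Fin 0)) : lisDrop π = 0 := by rw [lisDrop, hl]; simp
    simp [h, hl, hr, hd]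
  | succ m ih => rw [sum_perms321_transfer, ih, Function.iterate_succ_apply]
-- Folding two signed steps into one unsigned step.
section Folding

variable {R : Type*} [CommRing R]

theorem childSum_zero (ε : R) (g : ℕ → ℕ → R) (b : ℕ) : childSum ε g 0 b = 0 := by
  simp [childSum]

theorem childSum_succ (ε : R) (g : ℕ → ℕ → R) (r b : ℕ) :
    childSum ε g (r + 1) b = childSum ε g r b + ε ^ (r + 1) * g (r + 1) (min r b) := by
  rw [childSum, sum_range_succ, childSum]

theorem childSum_self (ε : R) (g : ℕ → ℕ → R) (r : ℕ) :
    childSum ε g (r + 1) (r + 1) = childSum ε g (r + 1) r := by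
  refine sum_congr rfl fun j hj => ?_
  rw [min_eq_left (by have := mem_range.1 hj; omega),
    min_eq_left (by have := mem_range.1 hj; omega)]

theorem childSum_neg_one_odd (g : ℕ → ℕ → R) (r b : ℕ) :
    childSum (-1) g (2 * r + 1) b = childSum (-1) g (2 * r) b - g (2 * r + 1) (min (2 * r) b) := by
  rw [childSum_succ, pow_succ, pow_mul]
  simp [sub_eq_add_neg]

theorem childSum_neg_one_even (g : ℕ → ℕ → R) (r b : ℕ) :
    childSum (-1) g (2 * r + 2) b =
      childSum (-1) g (2 * r + 1) b + g (2 * r + 2) (min (2 * r + 1) b) := by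
  rw [childSum_succ, show 2 * r + 1 + 1 = 2 * (r + 1) by ring, pow_mul]
  simp

theorem transfer_zero (ε t : R) (g : ℕ → ℕ → R) (r : ℕ) :
    transfer ε t g r 0 = t * g (r + 1) 1 + t * childSum ε g r 0 := by
  simp [transfer]

theorem transfer_succ (ε t : R) (g : ℕ → ℕ → R) (r a : ℕ) :
    transfer ε t g r (a + 1) = t * g (r + 1) (a + 2) + childSum ε g r a := by
  simp [transfer]

theorem childSum_congr {g h : ℕ → ℕ → R} (H : ∀ r, ∀ a ≤ r, g r a = h r a) (ε : R) (r b : ℕ) :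
    childSum ε g r b = childSum ε h r b :=
  sum_congr rfl fun j _ => by rw [H (j + 1) (min j b) ((min_le_left _ _).trans (Nat.le_succ j))]

/-- The region a ≤ r is closed under passing to children, so identities valid only there survive
iteration. -/
theorem transfer_congr {g h : ℕ → ℕ → R} (H : ∀ r, ∀ a ≤ r, g r a = h r a) (ε t : R) :
    ∀ r, ∀ a ≤ r, transfer ε t g r a = transfer ε t h r a := fun r a ha => by
  rw [transfer, transfer, H (r + 1) (a + 1) (Nat.succ_le_succ ha), childSum_congr H]

theorem transfer_const_mul (ε t c : R) (g : ℕ → ℕ → R) :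
    transfer ε t (fun r a => c * g r a) = fun r a => c * transfer ε t g r a := by
  funext r a
  simp only [transfer, childSum, mul_left_comm _ c, ← mul_sum, ← mul_add]

/-- The function on labels of the generating tree obtained from `u` by doubling, so that two
signed transfer steps correspond to one unsigned step with `q ^ 2` in place of `q`. -/
def double (q : R) (u : ℕ → ℕ → R) (r a : ℕ) : R :=
  if r % 2 = 0 then
    if a % 2 = 0 then (q + 1) * q * u (r / 2) (a / 2)
    else q * (u (r / 2) (a / 2) + q * u (r / 2) (a / 2 + 1))
  else if a = 0 then 0
  else q ^ 2 * u (r / 2) ((a - 1) / 2 + 1) - u (r / 2) ((a - 1) / 2)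

variable (q : R) (u : ℕ → ℕ → R) (r a : ℕ)

theorem double_even_even : double q u (2 * r) (2 * a) = (q + 1) * q * u r a := by
  simp [double]

theorem double_even_odd :
    double q u (2 * r) (2 * a + 1) = q * (u r a + q * u r (a + 1)) := by
  have h2 : (2 * a + 1) / 2 = a := by omega
  simp [double, h2, Nat.add_mod]

theorem double_odd_zero : double q u (2 * r + 1) 0 = 0 := by
  simp [double, Nat.add_mod]

theorem double_odd_odd :
    double q u (2 * r + 1) (2 * a + 1) = q ^ 2 * u r (a + 1) - u r a := by
  have h2 : (2 * r + 1) / 2 = r := by omega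
  simp [double, h2, Nat.add_mod]

theorem double_odd_even :
    double q u (2 * r + 1) (2 * a + 2) = q ^ 2 * u r (a + 1) - u r a := by
  have h2 : (2 * r + 1) / 2 = r := by omega
  have h3 : (2 * a + 1) / 2 = a := by omega
  simp [double, h2, h3, Nat.add_mod]

/-- In this and the next two sums the child labelled 1 contributes zero, and the children 2k and 2k
+ 1, of opposite sign, combine into a multiple of the k-th unsigned term. -/
theorem childSum_double_zero :
    childSum (-1) (double q u) (2 * r + 1) 0 = (q ^ 2 + q) * childSum 1 u r 0 := by
  induction r with
  | zero => simp [childSum, double]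
  | succ r ih =>
    rw [childSum_neg_one_odd, show 2 * (r + 1) = 2 * r + 2 by ring, childSum_neg_one_even, ih,
      childSum_succ, show 2 * r + 2 + 1 = 2 * (r + 1) + 1 by ring,
      show 2 * r + 2 = 2 * (r + 1) by ring, Nat.min_zero, Nat.min_zero, Nat.min_zero,
      double_odd_zero, show double q u (2 * (r + 1)) 0 = _ from double_even_even q u (r + 1) 0]
    ring

theorem childSum_double_odd (b : ℕ) :
    childSum (-1) (double q u) (2 * r + 1) (2 * b + 1) = (q + 1) * childSum 1 u r b := by
  induction r with
  | zero => simp [childSum, double]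
  | succ r ih =>
    rw [childSum_neg_one_odd, show 2 * (r + 1) = 2 * r + 2 by ring, childSum_neg_one_even, ih,
      childSum_succ, show 2 * r + 2 + 1 = 2 * (r + 1) + 1 by ring,
      show 2 * r + 2 = 2 * (r + 1) by ring]
    rcases le_or_gt b r with h | h
    · rw [min_eq_right (by omega), min_eq_right (by omega), min_eq_right h, double_even_odd,
        double_odd_odd]
      ring
    · rw [min_eq_left (by omega), min_eq_left (by omega), min_eq_left h.le, double_even_odd,
        show 2 * (r + 1) = 2 * r + 2 by ring, show 2 * r + 2 + 1 = 2 * (r + 1) + 1 by ring,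
        double_odd_even]
      ring

theorem childSum_double_even (b : ℕ) :
    childSum (-1) (double q u) (2 * r + 1) (2 * b + 2) =
      q * childSum 1 u r (b + 1) + childSum 1 u r b := by
  induction r with
  | zero => simp [childSum, double]
  | succ r ih =>
    rw [childSum_neg_one_odd, show 2 * (r + 1) = 2 * r + 2 by ring, childSum_neg_one_even, ih,
      childSum_succ, childSum_succ, show 2 * r + 2 + 1 = 2 * (r + 1) + 1 by ring,
      show 2 * r + 2 = 2 * (r + 1) by ring]
    rcases lt_or_ge b r with h | h
    · rw [min_eq_right (by omega), min_eq_right (by omega), min_eq_right h.le,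
        min_eq_right (by omega), double_odd_even, show 2 * b + 2 = 2 * (b + 1) by ring,
        double_even_even]
      ring
    · rw [min_eq_left (by omega), min_eq_left (by omega), min_eq_left h, min_eq_left (by omega),
        double_even_odd, show 2 * (r + 1) = 2 * r + 2 by ring,
        show 2 * r + 2 + 1 = 2 * (r + 1) + 1 by ring, double_odd_even]
      ring

theorem transfer_double_odd_zero :
    transfer (-1) q (double q u) (2 * r + 1) 0 =
      q ^ 2 * u (r + 1) 0 + q ^ 3 * u (r + 1) 1 + q ^ 2 * (q + 1) * childSum 1 u r 0 := by
  rw [transfer_zero, childSum_double_zero, show 2 * r + 1 + 1 = 2 * (r + 1) by ring,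
    show double q u (2 * (r + 1)) 1 = _ from double_even_odd q u (r + 1) 0]
  ring

theorem transfer_double_odd_one :
    transfer (-1) q (double q u) (2 * r + 1) 1 =
      q ^ 2 * (q + 1) * u (r + 1) 1 + (q ^ 2 + q) * childSum 1 u r 0 := by
  rw [transfer_succ, childSum_double_zero, show 2 * r + 1 + 1 = 2 * (r + 1) by ring,
    show double q u (2 * (r + 1)) 2 = _ from double_even_even q u (r + 1) 1]
  ring

theorem transfer_double_odd_odd :
    transfer (-1) q (double q u) (2 * r + 1) (2 * a + 3) =
      q ^ 2 * (q + 1) * u (r + 1) (a + 2) + q * childSum 1 u r (a + 1) + childSum 1 u r a := by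
  rw [transfer_succ, childSum_double_even, show 2 * r + 1 + 1 = 2 * (r + 1) by ring,
    show 2 * a + 2 + 2 = 2 * (a + 2) by ring, double_even_even]
  ring

theorem transfer_double_odd_even :
    transfer (-1) q (double q u) (2 * r + 1) (2 * a + 2) =
      q ^ 2 * u (r + 1) (a + 1) + q ^ 3 * u (r + 1) (a + 2) + (q + 1) * childSum 1 u r a := by
  rw [transfer_succ, childSum_double_odd, show 2 * r + 1 + 1 = 2 * (r + 1) by ring,
    show 2 * a + 1 + 2 = 2 * (a + 1) + 1 by ring, double_even_odd]
  ring

theorem transfer_double_even_one :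
    transfer (-1) q (double q u) (2 * r + 2) 1 =
      q ^ 3 * u (r + 1) 1 + q ^ 2 * u (r + 1) 0 + (q ^ 2 + q) * childSum 1 u r 0 := by
  rw [transfer_succ, childSum_neg_one_even, childSum_double_zero, Nat.min_zero,
    show 2 * r + 2 + 1 = 2 * (r + 1) + 1 by ring, show 2 * r + 2 = 2 * (r + 1) by ring,
    show double q u (2 * (r + 1) + 1) (0 + 2) = _ from double_odd_even q u (r + 1) 0,
    show double q u (2 * (r + 1)) 0 = _ from double_even_even q u (r + 1) 0]
  ring

theorem transfer_double_even_zero :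
    transfer (-1) q (double q u) (2 * r + 2) 0 =
      q ^ 3 * u (r + 1) 1 + (q ^ 3 + q ^ 2 - q) * u (r + 1) 0 +
        q ^ 2 * (q + 1) * childSum 1 u r 0 := by
  rw [transfer_zero, childSum_neg_one_even, childSum_double_zero, Nat.min_zero,
    show 2 * r + 2 + 1 = 2 * (r + 1) + 1 by ring, show 2 * r + 2 = 2 * (r + 1) by ring,
    show double q u (2 * (r + 1) + 1) 1 = _ from double_odd_odd q u (r + 1) 0,
    show double q u (2 * (r + 1)) 0 = _ from double_even_even q u (r + 1) 0]
  ring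

variable {r a}

theorem transfer_double_even_odd (h : a < r) :
    transfer (-1) q (double q u) (2 * r + 2) (2 * a + 3) =
      q ^ 3 * u (r + 1) (a + 2) + q ^ 2 * u (r + 1) (a + 1) + q * childSum 1 u r (a + 1) +
        childSum 1 u r a := by
  rw [transfer_succ, childSum_neg_one_even, childSum_double_even, min_eq_right (by omega),
    show 2 * r + 2 + 1 = 2 * (r + 1) + 1 by ring, show 2 * r + 2 = 2 * (r + 1) by ring,
    show 2 * a + 2 + 2 = 2 * (a + 1) + 2 by ring, double_odd_even,
    show 2 * a + 2 = 2 * (a + 1) by ring, double_even_even]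
  ring

theorem transfer_double_even_even (h : a ≤ r) :
    transfer (-1) q (double q u) (2 * r + 2) (2 * a + 2) =
      q ^ 3 * u (r + 1) (a + 2) + (q ^ 2 - q) * u (r + 1) (a + 1) + q * u (r + 1) a +
        (q + 1) * childSum 1 u r a := by
  rw [transfer_succ, childSum_neg_one_even, childSum_double_odd, min_eq_right (by omega),
    show 2 * r + 2 + 1 = 2 * (r + 1) + 1 by ring, show 2 * r + 2 = 2 * (r + 1) by ring,
    show 2 * a + 1 + 2 = 2 * (a + 1) + 1 by ring, double_odd_odd, double_even_odd]
  ring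

variable (r a)

/-- Here and in the next two sums the children 2k + 1 and 2k + 2 are paired: their inner `childSum`
terms cancel, leaving only values of `u` at k + 1. -/
theorem childSum_transfer_double_zero :
    childSum (-1) (transfer (-1) q (double q u)) (2 * r) 0 =
      q * (q ^ 2 - 1) * childSum 1 u r 0 := by
  induction r with
  | zero => simp [childSum]
  | succ r ih =>
    rw [show 2 * (r + 1) = 2 * r + 2 by ring, childSum_neg_one_even, childSum_neg_one_odd, ih,
      childSum_succ, Nat.min_zero, Nat.min_zero, Nat.min_zero, transfer_double_odd_zero,
      transfer_double_even_zero]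
    ring

theorem childSum_transfer_double_odd :
    childSum (-1) (transfer (-1) q (double q u)) (2 * r) (2 * a + 1) =
      q ^ 2 * (childSum 1 u r a - childSum 1 u r (a + 1)) := by
  induction r with
  | zero => simp [childSum]
  | succ r ih =>
    rw [show 2 * (r + 1) = 2 * r + 2 by ring, childSum_neg_one_even, childSum_neg_one_odd, ih,
      childSum_succ, childSum_succ]
    rcases lt_or_ge a r with h | h
    · rw [min_eq_right (by omega), min_eq_right (by omega), min_eq_right h.le, min_eq_right h]
      rcases a with _ | a
      · rw [Nat.mul_zero, Nat.zero_add, transfer_double_odd_one, transfer_double_even_one]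
        ring
      · rw [show 2 * (a + 1) + 1 = 2 * a + 3 by ring, transfer_double_odd_odd,
          transfer_double_even_odd q u (by omega)]
        ring
    -- The second label is now capped by the child's index, and the difference on the right gains
    -- nothing.
    · rw [min_eq_left (by omega), min_eq_left (by omega), min_eq_left h, min_eq_left (by omega)]
      rcases r with _ | r
      · rw [Nat.mul_zero, Nat.zero_add,
          show transfer (-1) q (double q u) 1 0 = _ from transfer_double_odd_zero q u 0,
          show transfer (-1) q (double q u) (0 + 2) 1 = _ from transfer_double_even_one q u 0]
        simp only [childSum_zero]
        ring
      · rw [show 2 * (r + 1) + 1 = 2 * r + 3 by ring, transfer_double_even_odd q u (by omega),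
          show 2 * r + 3 = 2 * (r + 1) + 1 by ring, show 2 * (r + 1) = 2 * r + 2 by ring,
          show 2 * r + 2 + 1 = 2 * (r + 1) + 1 by ring, transfer_double_odd_even, childSum_self]
        ring

theorem childSum_transfer_double_even :
    childSum (-1) (transfer (-1) q (double q u)) (2 * r) (2 * a + 2) =
      q * (childSum 1 u r a - childSum 1 u r (a + 1)) := by
  induction r with
  | zero => simp [childSum]
  | succ r ih =>
    rw [show 2 * (r + 1) = 2 * r + 2 by ring, childSum_neg_one_even, childSum_neg_one_odd, ih,
      childSum_succ, childSum_succ]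
    rcases lt_or_ge a r with h | h
    · rw [min_eq_right (by omega), min_eq_right (by omega), min_eq_right h.le, min_eq_right h,
        transfer_double_odd_even, transfer_double_even_even q u h.le]
      ring
    · rw [min_eq_left (by omega), min_eq_left (by omega), min_eq_left h, min_eq_left (by omega)]
      rcases r with _ | r
      · rw [Nat.mul_zero, Nat.zero_add,
          show transfer (-1) q (double q u) 1 0 = _ from transfer_double_odd_zero q u 0,
          show transfer (-1) q (double q u) (0 + 2) 1 = _ from transfer_double_even_one q u 0]
        simp only [childSum_zero]
        ring
      · rw [show 2 * (r + 1) + 1 = 2 * r + 3 by ring, transfer_double_even_odd q u (by omega),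
          show 2 * r + 3 = 2 * (r + 1) + 1 by ring, show 2 * (r + 1) = 2 * r + 2 by ring,
          show 2 * r + 2 + 1 = 2 * (r + 1) + 1 by ring, transfer_double_odd_even, childSum_self]
        ring

theorem transfer_transfer_double (h : a ≤ r) :
    transfer (-1) q (transfer (-1) q (double q u)) r a =
      double q (transfer 1 (q ^ 2) u) r a := by
  obtain ⟨r, rfl | rfl⟩ := Nat.even_or_odd' r <;> obtain ⟨a, rfl | rfl⟩ := Nat.even_or_odd' a
  · rcases a with _ | a
    · rw [double_even_even, Nat.mul_zero, transfer_zero, transfer_zero,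
        childSum_transfer_double_zero, transfer_double_odd_one]
      ring
    · rw [double_even_even, show 2 * (a + 1) = 2 * a + 1 + 1 by ring,
        transfer_succ (-1) q (transfer (-1) q (double q u)), childSum_transfer_double_odd,
        show 2 * a + 1 + 2 = 2 * a + 3 by ring, transfer_double_odd_odd, transfer_succ]
      ring
  · rw [double_even_odd, transfer_succ, transfer_double_odd_even]
    rcases a with _ | a
    · rw [Nat.mul_zero, childSum_transfer_double_zero, transfer_zero, transfer_succ]
      ring
    · rw [show 2 * (a + 1) = 2 * a + 2 by ring, childSum_transfer_double_even, transfer_succ,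
        transfer_succ]
      ring
  · rcases a with _ | a
    · rw [Nat.mul_zero, double_odd_zero, transfer_zero, childSum_neg_one_odd, Nat.min_zero,
        childSum_transfer_double_zero, transfer_double_odd_zero, transfer_double_even_one]
      ring
    · rw [show 2 * (a + 1) = 2 * a + 2 by ring, double_odd_even,
        show 2 * a + 2 = 2 * a + 1 + 1 by ring,
        transfer_succ (-1) q (transfer (-1) q (double q u)), childSum_neg_one_odd,
        min_eq_right (by omega), childSum_transfer_double_odd,
        show 2 * a + 1 + 2 = 2 * a + 3 by ring, transfer_double_even_odd q u (by omega),
        transfer_succ 1]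
      rcases a with _ | a
      · rw [Nat.mul_zero, Nat.zero_add, transfer_double_odd_one, transfer_zero]
        ring
      · rw [show 2 * (a + 1) + 1 = 2 * a + 3 by ring, transfer_double_odd_odd, transfer_succ]
        ring
  · rw [double_odd_odd, transfer_succ, childSum_neg_one_odd, min_eq_right (by omega),
      transfer_double_even_even q u (by omega), transfer_succ]
    rcases a with _ | a
    · rw [Nat.mul_zero, childSum_transfer_double_zero, transfer_double_odd_zero, transfer_zero]
      ring
    · rw [show 2 * (a + 1) = 2 * a + 2 by ring, childSum_transfer_double_even,
        transfer_double_odd_even, transfer_succ]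
      ring

/-- The alternating child sum of the constant 1 is 0 for even r and -1 for odd r. -/
theorem transfer_one_eq_double :
    (q + 1) * transfer (-1) q (fun _ _ => 1) r a = double q (fun _ _ => 1) r a := by
  have heven (r b : ℕ) : childSum (-1 : R) (fun _ _ => 1) (2 * r) b = 0 := by
    induction r with
    | zero => exact childSum_zero _ _ _
    | succ r ih =>
      rw [show 2 * (r + 1) = 2 * r + 2 by ring, childSum_neg_one_even, childSum_neg_one_odd, ih]
      ring
  have hodd (r b : ℕ) : childSum (-1 : R) (fun _ _ => 1) (2 * r + 1) b = -1 := by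
    rw [childSum_neg_one_odd, heven]
    ring
  obtain ⟨r, rfl | rfl⟩ := Nat.even_or_odd' r <;> obtain ⟨a, rfl | rfl⟩ := Nat.even_or_odd' a
  · rw [transfer, heven, double_even_even]
    ring
  · rw [transfer, heven, double_even_odd]
    ring
  · rcases a with _ | a
    · rw [Nat.mul_zero, transfer_zero, hodd, double_odd_zero]
      ring
    · rw [show 2 * (a + 1) = 2 * a + 1 + 1 by ring, transfer_succ, hodd, double_odd_even]
      ring
  · rw [transfer_succ, hodd, double_odd_odd]
    ring

theorem iterate_transfer_eq_double (n : ℕ) : ∀ r, ∀ a ≤ r,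
    (q + 1) * (transfer (-1) q)^[2 * n + 1] (fun _ _ => 1) r a =
      double q ((transfer 1 (q ^ 2))^[n] fun _ _ => 1) r a := by
  induction n with
  | zero => exact fun r a _ => transfer_one_eq_double q r a
  | succ n ih =>
    intro r a h
    rw [show 2 * (n + 1) + 1 = 2 * n + 1 + 1 + 1 by ring, Function.iterate_succ_apply',
      Function.iterate_succ_apply', Function.iterate_succ_apply' _ n,
      ← transfer_transfer_double q _ r a h,
      ← transfer_congr (transfer_congr ih (-1) q) (-1) q r a h, transfer_const_mul,
      transfer_const_mul]

theorem childSum_eq_of_le (ε : R) (g : ℕ → ℕ → R) {r a : ℕ} (h : r ≤ a) :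
    childSum ε g r (a - 1) = childSum ε g r (r - 1) := by
  refine sum_congr rfl fun j hj => ?_
  have := mem_range.1 hj
  rw [min_eq_left (by omega), min_eq_left (by omega)]

/-- The cap a - 1 has no effect once a ≥ r, and the test a = 0 can differ only at r = 0, where there
are no children to weight. This is needed because `double` at (1, 1) reads its argument at (0, 1),
outside a ≤ r. -/
theorem iterate_transfer_eq_of_le (ε t : R) (n : ℕ) {r a : ℕ} (h : r ≤ a) :
    (transfer ε t)^[n] (fun _ _ => 1) r a = (transfer ε t)^[n] (fun _ _ => 1) r r := by
  induction n generalizing r a with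
  | zero => rfl
  | succ n ih =>
    rw [Function.iterate_succ_apply', transfer, transfer, ih (Nat.succ_le_succ h),
      childSum_eq_of_le ε _ h]
    rcases r with _ | r
    · simp [childSum_zero]
    · rw [if_neg (by omega), if_neg (by omega)]

end Folding

/-! ### Specialization to ℤ[q] and conclusion. -/

theorem sum_sign_perms321_eq (m : ℕ) :
    ∑ π ∈ perms321 m, C ((Equiv.Perm.sign π : ℤˣ) : ℤ) * (X : ℤ[X]) ^ lis π =
      (transfer (-1) X)^[m] (fun _ _ => 1) 0 0 := by
  have := sum_perms321_eq_iterate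
    (((C : ℤ →+* ℤ[X]) : ℤ →* ℤ[X]).comp (Units.coeHom ℤ)) X m fun _ _ => 1
  simpa using this

theorem sum_perms321_eq (m : ℕ) :
    ∑ π ∈ perms321 m, (X : ℤ[X]) ^ (2 * lis π + 1) =
      X * (transfer 1 (X ^ 2))^[m] (fun _ _ => 1) 0 0 := by
  have := sum_perms321_eq_iterate (1 : ℤˣ →* ℤ[X]) (X ^ 2) m fun _ _ => 1
  simp only [MonoidHom.one_apply, one_mul, mul_one] at this
  rw [← this, mul_sum]
  exact sum_congr rfl fun π _ => by ring

theorem theorem1p1 (n : ℕ) (hn : 1 ≤ n) :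
    (∑ π ∈ perms321 (2 * n + 1), C ((Equiv.Perm.sign π : ℤˣ) : ℤ) * X ^ lis π
        = ∑ π ∈ perms321 n, (X : ℤ[X]) ^ (2 * lis π + 1)) ∧
    (∑ π ∈ perms321 (2 * n + 2), C ((Equiv.Perm.sign π : ℤˣ) : ℤ) * X ^ lis π
        = (X - 1) * ∑ π ∈ perms321 n, (X : ℤ[X]) ^ (2 * lis π + 1)) := by
  have hX : (X + 1 : ℤ[X]) ≠ 0 := (monic_X_add_C 1).ne_zero
  rw [sum_sign_perms321_eq, sum_sign_perms321_eq, sum_perms321_eq]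
  constructor
  · refine mul_left_cancel₀ hX ?_
    rw [iterate_transfer_eq_double X n 0 0 le_rfl, ← Nat.mul_zero 2, double_even_even]
    ring
  · refine mul_left_cancel₀ hX ?_
    have h : double (X : ℤ[X]) ((transfer 1 (X ^ 2))^[n] fun _ _ => 1) 1 1 =
      (X ^ 2 - 1) * (transfer 1 (X ^ 2))^[n] (fun _ _ => 1) 0 0 := by
      rw [show double (X : ℤ[X]) _ 1 1 = _ from double_odd_odd X _ 0 0,
        iterate_transfer_eq_of_le _ _ _ (Nat.zero_le _)]
      ring
    -- The root (0, 0) has the single child (1, 1), so the last step reduces to q times the odd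
    -- iterate there.
    rw [Function.iterate_succ_apply', transfer_zero, childSum_zero, mul_zero, add_zero,
      mul_left_comm, iterate_transfer_eq_double X n 1 1 le_rfl, h]
    ring
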